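/- Let $G$ be a connected locally compact (Hausdorff) group with a left Haar measure $\mu$ and a right Haar measure $\nu$. For compact sets $A,B\subseteq G$ of positive measure, let $\mathrm{BM}(A,B)$ denote the real number $r>0$ such that \[ \left(\frac{\nu(A)}{\nu(AB)}\right)^{1/r}+\left(\frac{\mu(B)}{\mu(AB)}\right)^{1/r}=1 , \] where $AB=\{ab: a\in A,\ b\in B\}$, and let $\mathrm{BM}(G)$ be the largest real number $r\ge 0$ such that $\mathrm{BM}(A,B)\ge r$ for all compact $A,B\subseteq G$ of positive measure. Suppose that $G$ is not unimodular (that is, $\mu$ is not right invariant) and that $\mathrm{BM}(G)=2$. Then every compact set $A\subseteq G$ of positive measure satisfies, with $A^2=AA$, \[ \left(\frac{\nu(A)}{\nu(A^2)}\right)^{1/2}+\left(\frac{\mu(A)}{\mu(A^2)}\right)^{1/2}<1 . \] -/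

import Mathlib

open MeasureTheory
open scoped Pointwise

/-- `r` is the Brunn–Minkowski coefficient `BM(A, B)` of the pair `(A, B)`, where `μ` is a left and
`ν` a right Haar measure: `(ν(A)/ν(AB))^{1/r} + (μ(B)/μ(AB))^{1/r} = 1`. (The exponent `1/r` makes
sense for `r > 0` only.) -/
def IsPairBMCoeff {G : Type*} [Group G] [MeasurableSpace G] (μ ν : Measure G) (A B : Set G)
    (r : ℝ) : Prop :=
  0 < r ∧ (ν.real A / ν.real (A * B)) ^ (1 / r) + (μ.real B / μ.real (A * B)) ^ (1 / r) = 1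

/-- `r` is the Brunn–Minkowski coefficient `BM(G)` of the group `G`, where `μ` is a left and `ν` a
right Haar measure: the largest real number `r ≥ 0` such that `BM(A, B) ≥ r` for all compact sets
`A, B` of positive measure (for null sets the equation defining `BM(A, B)` may hold for every `r`,
or for none). -/
def IsGroupBMCoeff {G : Type*} [Group G] [TopologicalSpace G] [MeasurableSpace G]
    (μ ν : Measure G) (r : ℝ) : Prop :=
  IsGreatest {s : ℝ | 0 ≤ s ∧ ∀ A B : Set G, IsCompact A → IsCompact B → 0 < ν A → 0 < μ B →
    ∃ t : ℝ, IsPairBMCoeff μ ν A B t ∧ s ≤ t} r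

/-!
Let `Δ` be the modular character. Since `G` is connected and `Δ` is nontrivial, `ker Δ` is not
open, so by Steinhaus' theorem the level sets of `Δ` are null on compact sets. Hence `A` can be cut
at a level `a` of `Δ` into two halves `A₁ ⊆ {Δ ≤ a}`, `A₂ ⊆ {a ≤ Δ}` of equal `ν`-measure, and `B`
at a level `b` into two halves of equal `μ`-measure. The products `A₁B₁ ⊆ {Δ ≤ ab}` and
`A₂B₂ ⊆ {ab ≤ Δ}` are almost disjoint subsets of `AB`. Apply the Brunn–Minkowski inequality to
`(A₁, B₁)` and `(A₂, B₂)`: as `(x, y) ↦ (α / x) ^ p + (β / y) ^ p` is strictly convex, the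
inequality for `(A, B)` is strict unless `A₁B₁` and `A₂B₂` have the same `μ`-measure and the same
`ν`-measure. That is impossible, because up to a constant `ν` has density `Δ` with respect to `μ`.
-/

open Measure Set Filter
open scoped NNReal ENNReal

section Convexity

lemma strictConvexOn_div_rpow {a p : ℝ} (ha : 0 < a) (hp : 0 < p) :
    StrictConvexOn ℝ (Ioi 0) fun x : ℝ ↦ (a / x) ^ p := by
  have hexp : ∀ x ∈ Ioi (0 : ℝ), (a / x) ^ p = Real.exp (p * (Real.log a - Real.log x)) :=
    fun x hx ↦ by rw [Real.rpow_def_of_pos (div_pos ha hx), Real.log_div ha.ne' hx.ne', mul_comm]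
  refine ⟨convex_Ioi 0, fun x hx y hy hxy u v hu hv huv ↦ ?_⟩
  have hlog := strictConcaveOn_log_Ioi.2 hx hy hxy hu hv huv
  simp only [hexp x hx, hexp y hy, hexp _ (convex_Ioi 0 hx hy hu.le hv.le huv)]
  refine lt_of_lt_of_le (Real.exp_lt_exp.mpr ?_)
    (convexOn_exp.2 (mem_univ _) (mem_univ _) hu.le hv.le huv)
  calc p * (Real.log a - Real.log (u • x + v • y))
    _ < p * ((u + v) * Real.log a - (u • Real.log x + v • Real.log y)) := by
      rw [huv, one_mul]; gcongr
    _ = u • (p * (Real.log a - Real.log x)) + v • (p * (Real.log a - Real.log y)) := by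
      simp only [smul_eq_mul]; ring

lemma strictConvexOn_prod_add {E F : Type*} [AddCommGroup E] [Module ℝ E] [AddCommGroup F]
    [Module ℝ F] {s : Set E} {t : Set F} {f : E → ℝ} {g : F → ℝ}
    (hf : StrictConvexOn ℝ s f) (hg : StrictConvexOn ℝ t g) :
    StrictConvexOn ℝ (s ×ˢ t) fun z ↦ f z.1 + g z.2 := by
  refine ⟨hf.1.prod hg.1, fun x hx y hy hxy u v hu hv huv ↦ ?_⟩
  have hf_le := hf.convexOn.2 hx.1 hy.1 hu.le hv.le huv
  have hg_le := hg.convexOn.2 hx.2 hy.2 hu.le hv.le huv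
  simp only [smul_add, Prod.fst_add, Prod.snd_add, Prod.smul_fst, Prod.smul_snd]
  by_cases h : x.1 = y.1
  · have := hg.2 hx.2 hy.2 (fun h' ↦ hxy (Prod.ext h h')) hu hv huv
    linarith
  · have := hf.2 hx.1 hy.1 h hu hv huv
    linarith

lemma div_rpow_add_div_rpow_lt_one {a b p N N₁ N₂ M M₁ M₂ : ℝ} (ha : 0 < a) (hb : 0 < b)
    (hp : 0 < p) (hN₁ : 0 < N₁) (hN₂ : 0 < N₂) (hM₁ : 0 < M₁) (hM₂ : 0 < M₂)
    (hN : N₁ + N₂ ≤ N) (hM : M₁ + M₂ ≤ M)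
    (h₁ : (a / 2 / N₁) ^ p + (b / 2 / M₁) ^ p ≤ 1) (h₂ : (a / 2 / N₂) ^ p + (b / 2 / M₂) ^ p ≤ 1)
    (hne : ¬(N₁ = N₂ ∧ M₁ = M₂)) :
    (a / N) ^ p + (b / M) ^ p < 1 := by
  have hmid := (strictConvexOn_prod_add (strictConvexOn_div_rpow (half_pos ha) hp)
    (strictConvexOn_div_rpow (half_pos hb) hp)).lt_on_open_segment'
    (x := (N₁, M₁)) (y := (N₂, M₂)) ⟨hN₁, hM₁⟩ ⟨hN₂, hM₂⟩ (by simpa using hne)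
    one_half_pos one_half_pos (add_halves 1)
  have hhalf (x y z : ℝ) : x / 2 / ((1 / 2 : ℝ) • y + (1 / 2 : ℝ) • z) = x / (y + z) := by
    rw [← smul_add, smul_eq_mul, one_div_mul_eq_div, div_div_div_cancel_right₀ two_ne_zero]
  simp only [Prod.smul_mk, Prod.mk_add_mk, hhalf] at hmid
  have hN₀ : 0 < N := (add_pos hN₁ hN₂).trans_le hN
  have hM₀ : 0 < M := (add_pos hM₁ hM₂).trans_le hM
  calc (a / N) ^ p + (b / M) ^ p
    _ ≤ (a / (N₁ + N₂)) ^ p + (b / (M₁ + M₂)) ^ p := by gcongr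
    _ < 1 := hmid.trans_le (max_le h₁ h₂)

end Convexity

section Median

lemma continuous_measureReal_Iic (ρ : Measure ℝ) [IsFiniteMeasure ρ] [NullSingletonClass ρ] :
    Continuous fun c ↦ ρ.real (Iic c) := by
  have hprim : Continuous fun c ↦ ∫ _ in 0..c, (1 : ℝ) ∂ρ :=
    intervalIntegral.continuous_primitive (fun _ _ ↦ intervalIntegrable_const) 0
  convert hprim.add_const (ρ.real (Iic 0)) using 2 with c
  rw [← sub_eq_iff_eq_add, ← intervalIntegral.integral_Iic_sub_Iic
    (integrable_const _).integrableOn (integrable_const _).integrableOn]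
  simp

lemma exists_measureReal_Iic_eq_half (ρ : Measure ℝ) [IsFiniteMeasure ρ] [NullSingletonClass ρ]
    [NeZero ρ] : ∃ c, ρ.real (Iic c) = ρ.real univ / 2 ∧ ρ.real (Ici c) = ρ.real univ / 2 := by
  have hadd (c : ℝ) : ρ.real (Iic c) + ρ.real (Ici c) = ρ.real univ := by
    rw [← measureReal_congr Ioi_ae_eq_Ici, ← compl_Iic,
      measureReal_add_measureReal_compl measurableSet_Iic]
  have hhalf : ρ.real univ / 2 < ρ.real univ := half_lt_self measureReal_univ_pos
  obtain ⟨c, hc⟩ : ρ.real univ / 2 ∈ range fun c ↦ ρ.real (Iic c) := by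
    refine mem_range_of_exists_le_of_exists_ge (continuous_measureReal_Iic ρ) ?_ ?_
    · have htop := (ENNReal.tendsto_toReal (measure_ne_top ρ univ)).comp
        (tendsto_measure_Ici_atBot ρ)
      obtain ⟨c, hc⟩ := (htop.eventually_const_lt hhalf).exists
      exact ⟨c, by linarith [hadd c, (show _ < ρ.real (Ici c) from hc)]⟩
    · have htop := (ENNReal.tendsto_toReal (measure_ne_top ρ univ)).comp
        (tendsto_measure_Iic_atTop ρ)
      exact (htop.eventually_const_le hhalf).exists
  exact ⟨c, hc, by linarith [hadd c, (show ρ.real (Iic c) = _ from hc)]⟩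

lemma exists_measureReal_preimage_Iic_eq_half {X : Type*} [MeasurableSpace X] (m : Measure X)
    [IsFiniteMeasure m] [NeZero m] {f : X → ℝ} (hf : Measurable f)
    (hlevel : ∀ c, m (f ⁻¹' {c}) = 0) :
    ∃ c, m.real (f ⁻¹' Iic c) = m.real univ / 2 ∧ m.real (f ⁻¹' Ici c) = m.real univ / 2 := by
  have : NeZero (m.map f) := ⟨(Measure.map_ne_zero_iff hf.aemeasurable).mpr (NeZero.ne m)⟩
  have : NullSingletonClass (m.map f) :=
    ⟨fun c ↦ by rw [Measure.map_apply hf (measurableSet_singleton c), hlevel]⟩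
  simpa only [map_measureReal_apply hf measurableSet_Iic,
    map_measureReal_apply hf measurableSet_Ici, map_measureReal_apply hf MeasurableSet.univ,
    preimage_univ]
    using exists_measureReal_Iic_eq_half (m.map f)

lemma exists_isCompact_halves {X : Type*} [TopologicalSpace X] [MeasurableSpace X]
    [OpensMeasurableSpace X] (m : Measure X) [IsFiniteMeasureOnCompacts m]
    {f : X → ℝ≥0} (hf : Continuous f) {A : Set X} (hA : IsCompact A) (hA₀ : m A ≠ 0)
    (hlevel : ∀ c, m (A ∩ f ⁻¹' {c}) = 0) :
    ∃ c, ∃ A₁ ⊆ A, ∃ A₂ ⊆ A, IsCompact A₁ ∧ IsCompact A₂ ∧ (∀ x ∈ A₁, f x ≤ c) ∧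
      (∀ x ∈ A₂, c ≤ f x) ∧ m.real A₁ = m.real A / 2 ∧ m.real A₂ = m.real A / 2 := by
  have : IsFiniteMeasure (m.restrict A) := ⟨by simpa using hA.measure_lt_top⟩
  have : NeZero (m.restrict A) := ⟨by simpa using hA₀⟩
  have hfR : Continuous fun x ↦ (f x : ℝ) := by fun_prop
  have happly {s : Set ℝ} (hs : MeasurableSet s) :
      m.restrict A ((f · : X → ℝ) ⁻¹' s) = m (A ∩ (f · : X → ℝ) ⁻¹' s) := by
    rw [Measure.restrict_apply (hfR.measurable hs), inter_comm]
  obtain ⟨c, hc₁, hc₂⟩ := exists_measureReal_preimage_Iic_eq_half (m.restrict A) hfR.measurable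
    fun c ↦ by
      rw [happly (measurableSet_singleton c)]
      refine measure_mono_null ?_ (hlevel c.toNNReal)
      rintro x ⟨hxA, rfl⟩
      simp [hxA]
  have hc₀ : 0 ≤ c := by
    obtain ⟨x, hx⟩ := nonempty_of_measureReal_ne_zero
      (hc₁.trans_ne (half_pos measureReal_univ_pos).ne')
    exact (f x).coe_nonneg.trans hx
  lift c to ℝ≥0 using hc₀
  simp only [measureReal_def, happly measurableSet_Iic, happly measurableSet_Ici,
    Measure.restrict_apply_univ] at hc₁ hc₂
  exact ⟨c, _, inter_subset_left, _, inter_subset_left, hA.inter_right (isClosed_Iic.preimage hfR),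
    hA.inter_right (isClosed_Ici.preimage hfR), fun x hx ↦ hx.2, fun x hx ↦ hx.2, hc₁, hc₂⟩

end Median

section LevelSets

variable {X : Type*} [MeasurableSpace X] {m : Measure X} {P Q S : Set X}

lemma measureReal_add_le_of_le_of_le {α : Type*} [PartialOrder α] {f : X → α} {c : α}
    (hQ : MeasurableSet Q) (hPS : P ⊆ S) (hQS : Q ⊆ S) (hS : m S ≠ ∞) (hPc : ∀ x ∈ P, f x ≤ c)
    (hlevel : m (P ∩ f ⁻¹' {c}) = 0) (hQc : ∀ x ∈ Q, c ≤ f x) :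
    m.real P + m.real Q ≤ m.real S := by
  have hPQ : m (P ∩ Q) = 0 :=
    measure_mono_null
      (subset_inter inter_subset_left fun x hx ↦ (hPc x hx.1).antisymm (hQc x hx.2)) hlevel
  calc m.real P + m.real Q
    _ = m.real (P ∪ Q) := by
      rw [← measureReal_union_add_inter hQ (measure_ne_top_of_subset hPS hS)
        (measure_ne_top_of_subset hQS hS), measureReal_def m (P ∩ Q), hPQ, ENNReal.toReal_zero,
        add_zero]
    _ ≤ m.real S := measureReal_mono (union_subset hPS hQS) hS

lemma setLIntegral_lt_setLIntegral_of_le_of_le {f : X → ℝ≥0} {c : ℝ≥0}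
    (hP : MeasurableSet P) (hQ : MeasurableSet Q) (hPQ : m P = m Q) (hP₀ : m P ≠ 0)
    (hP_top : m P ≠ ∞) (hPc : ∀ x ∈ P, f x ≤ c) (hlevel : m (P ∩ f ⁻¹' {c}) = 0)
    (hQc : ∀ x ∈ Q, c ≤ f x) :
    ∫⁻ x in P, f x ∂m < ∫⁻ x in Q, f x ∂m := by
  have hlt : ∀ᵐ x ∂m, x ∈ P → f x < c := by
    filter_upwards [measure_eq_zero_iff_ae_notMem.mp hlevel] with x hx hxP
    exact (hPc x hxP).lt_of_ne fun h ↦ hx ⟨hxP, h⟩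
  have hfin : ∫⁻ x in P, f x ∂m ≠ ∞ := by
    refine ne_top_of_le_ne_top (ENNReal.mul_ne_top (ENNReal.coe_ne_top (r := c)) hP_top) ?_
    rw [← setLIntegral_const]
    exact setLIntegral_mono measurable_const fun x hx ↦ by exact_mod_cast hPc x hx
  calc ∫⁻ x in P, f x ∂m
    _ < ∫⁻ _ in P, c ∂m := setLIntegral_strict_mono hP hP₀ measurable_const hfin
        (hlt.mono fun x hx hxP ↦ by exact_mod_cast hx hxP)
    _ = ∫⁻ _ in Q, c ∂m := by rw [setLIntegral_const, setLIntegral_const, hPQ]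
    _ ≤ ∫⁻ x in Q, f x ∂m := setLIntegral_mono' hQ fun x hx ↦ by exact_mod_cast hQc x hx

end LevelSets

section ModularCharacter

variable {G : Type*} [Group G] [TopologicalSpace G] [IsTopologicalGroup G] [LocallyCompactSpace G]

lemma continuous_modularCharacterFun : Continuous (modularCharacterFun : G → ℝ≥0) := by
  borelize G
  set μ : Measure G := haar
  obtain ⟨f, hf⟩ : ∃ f : C(G, ℝ), HasCompactSupport f ∧ 0 ≤ f ∧ f 1 ≠ 0 :=
    exists_continuous_nonneg_pos 1
  have hformula (g : G) :
      (modularCharacterFun g : ℝ) = (∫ y, f (y⁻¹ * g) ∂μ.inv) / ∫ x, f x ∂μ := by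
    rw [modularCharacterFun_eq_haarScalarFactor μ g,
      haarScalarFactor_eq_integral_div_of_continuous_nonneg_pos _ _ hf,
      integral_map (measurable_mul_const g).aemeasurable f.continuous.aestronglyMeasurable,
      Measure.inv, integral_map measurable_inv.aemeasurable
        (by fun_prop : Continuous fun y ↦ f (y⁻¹ * g)).aestronglyMeasurable]
    simp only [inv_inv]
  refine NNReal.isEmbedding_coe.continuous_iff.mpr ?_
  simp only [Function.comp_def, hformula]
  exact (continuous_integral_apply_inv_mul f.continuous hf.1).div_const _

variable [MeasurableSpace G] [BorelSpace G]

lemma map_mul_right_eq_modularCharacterFun_smul_of_regular (μ : Measure G) [μ.IsHaarMeasure]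
    [μ.Regular] (g : G) : μ.map (· * g) = modularCharacterFun g • μ := by
  have : (μ.map (· * g)).Regular := Regular.map (Homeomorph.mulRight g)
  rw [modularCharacterFun_eq_haarScalarFactor μ g]
  exact isMulLeftInvariant_eq_smul_of_regular _ μ

lemma isMulRightInvariant_withDensity_modularCharacterFun (μ : Measure G) [μ.IsHaarMeasure]
    [μ.Regular] :
    (μ.withDensity fun x ↦ (modularCharacterFun x : ℝ≥0∞)).IsMulRightInvariant := by
  have hΔ : Measurable fun x : G ↦ (modularCharacterFun x : ℝ≥0∞) :=
    continuous_modularCharacterFun.measurable.coe_nnreal_ennreal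
  refine ⟨fun g ↦ Measure.ext fun s hs ↦ ?_⟩
  have hg : Measurable (· * g) := measurable_mul_const g
  have hg₀ : (modularCharacterFun g : ℝ≥0∞) ≠ 0 := by exact_mod_cast (modularCharacterFun_pos g).ne'
  rw [Measure.map_apply hg hs, withDensity_apply _ (hg hs), withDensity_apply _ hs,
    ← ENNReal.mul_right_inj hg₀ ENNReal.coe_ne_top]
  calc (modularCharacterFun g : ℝ≥0∞) * ∫⁻ x in (· * g) ⁻¹' s, modularCharacterFun x ∂μ
    _ = ∫⁻ x in (· * g) ⁻¹' s, modularCharacterFun (x * g) ∂μ := by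
      rw [← lintegral_const_mul _ hΔ]
      simp only [modularCharacterFun_map_mul, ENNReal.coe_mul, mul_comm]
    _ = ∫⁻ x in s, modularCharacterFun x ∂(μ.map (· * g)) := (setLIntegral_map hs hΔ hg).symm
    _ = modularCharacterFun g * ∫⁻ x in s, modularCharacterFun x ∂μ := by
      rw [map_mul_right_eq_modularCharacterFun_smul_of_regular, Measure.restrict_smul,
        lintegral_smul_measure, ENNReal.smul_def, smul_eq_mul]

lemma measure_restrict_eq_haarScalarFactor_smul (μ' μ : Measure G) [μ.IsHaarMeasure]
    [IsFiniteMeasureOnCompacts μ'] [μ'.IsMulLeftInvariant] {K : Set G}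
    (hK : IsCompact (closure K)) :
    μ'.restrict K = haarScalarFactor μ' μ • μ.restrict K := by
  ext s hs
  rw [Measure.smul_apply, Measure.restrict_apply hs, Measure.restrict_apply hs]
  exact measure_isMulInvariant_eq_smul_of_isCompact_closure _ _
    (hK.closure_of_subset (inter_subset_right.trans subset_closure))

lemma exists_measure_eq_mul_setLIntegral_modularCharacterFun [T2Space G] (μ ν : Measure G)
    [μ.IsHaarMeasure] [ν.IsMulRightInvariant] [IsFiniteMeasureOnCompacts ν] [ν.IsOpenPosMeasure] :
    ∃ k : ℝ≥0, k ≠ 0 ∧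
      ∀ K : Set G, IsCompact K → ν K = k * ∫⁻ x in K, modularCharacterFun x ∂μ := by
  set ν₀ : Measure G := haar.withDensity fun x ↦ (modularCharacterFun x : ℝ≥0∞)
  have : ν₀.IsMulRightInvariant := isMulRightInvariant_withDensity_modularCharacterFun haar
  have : IsLocallyFiniteMeasure ν₀ :=
    IsLocallyFiniteMeasure.withDensity_coe continuous_modularCharacterFun
  have hac : (haar : Measure G) ≪ ν₀ := withDensity_absolutelyContinuous'
    continuous_modularCharacterFun.measurable.coe_nnreal_ennreal.aemeasurable
    (ae_of_all _ fun x ↦ by exact_mod_cast (modularCharacterFun_pos x).ne')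
  have : ν₀.IsOpenPosMeasure := hac.isOpenPosMeasure
  have : ν₀.inv.IsHaarMeasure := {}
  have : ν.inv.IsHaarMeasure := {}
  refine ⟨haarScalarFactor ν.inv ν₀.inv * haarScalarFactor haar μ,
    mul_ne_zero (haarScalarFactor_pos_of_isHaarMeasure _ _).ne'
      (haarScalarFactor_pos_of_isHaarMeasure _ _).ne', fun K hK ↦ ?_⟩
  calc ν K
    _ = ν.inv K⁻¹ := by rw [Measure.inv_apply, inv_inv]
    _ = haarScalarFactor ν.inv ν₀.inv * ν₀ K := by
      rw [measure_isMulInvariant_eq_smul_of_isCompact_closure ν.inv ν₀.inv hK.inv.closure,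
        Measure.inv_apply, inv_inv, ENNReal.smul_def, smul_eq_mul]
    _ = ↑(haarScalarFactor ν.inv ν₀.inv * haarScalarFactor haar μ) *
        ∫⁻ x in K, modularCharacterFun x ∂μ := by
      rw [withDensity_apply _ hK.measurableSet,
        measure_restrict_eq_haarScalarFactor_smul haar μ hK.closure, lintegral_smul_measure,
        ENNReal.smul_def, smul_eq_mul, ENNReal.coe_mul, mul_assoc]

lemma measure_eq_zero_iff_of_isCompact [T2Space G] (μ ν : Measure G) [μ.IsHaarMeasure]
    [ν.IsMulRightInvariant] [IsFiniteMeasureOnCompacts ν] [ν.IsOpenPosMeasure] {K : Set G}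
    (hK : IsCompact K) : ν K = 0 ↔ μ K = 0 := by
  obtain ⟨k, hk₀, hk⟩ := exists_measure_eq_mul_setLIntegral_modularCharacterFun μ ν
  have hΔ : Measurable fun x : G ↦ (modularCharacterFun x : ℝ≥0∞) :=
    continuous_modularCharacterFun.measurable.coe_nnreal_ennreal
  have hpos : ∀ x : G, modularCharacterFun x ≠ 0 := fun x ↦ (modularCharacterFun_pos x).ne'
  simp [hk K hK, hk₀, lintegral_eq_zero_iff hΔ, Filter.EventuallyEq, hpos]

lemma measure_eq_zero_of_div_subset (μ : Measure G) [μ.IsHaarMeasure] {H : Subgroup G}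
    (hH : ¬IsOpen (H : Set G)) {K : Set G} (hK : IsCompact K) (hKm : MeasurableSet K)
    (hKH : K / K ⊆ H) : μ K = 0 := by
  rw [measure_isMulInvariant_eq_smul_of_isCompact_closure μ haar hK.closure, smul_eq_zero]
  refine Or.inr (by_contra fun hpos ↦ hH (H.isOpen_of_mem_nhds (g := 1) ?_))
  exact mem_of_superset (div_mem_nhds_one_of_haar_pos_ne_top haar K hKm
    (pos_iff_ne_zero.mpr hpos) hK.measure_ne_top) hKH

lemma measure_inter_modularCharacterFun_preimage_singleton [T2Space G] (μ : Measure G)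
    [μ.IsHaarMeasure] (hker : ¬IsOpen ((modularCharacter (G := G)).ker : Set G)) {K : Set G}
    (hK : IsCompact K) (c : ℝ≥0) : μ (K ∩ modularCharacterFun ⁻¹' {c}) = 0 := by
  have hL : IsCompact (K ∩ modularCharacterFun ⁻¹' {c}) :=
    hK.inter_right (isClosed_singleton.preimage continuous_modularCharacterFun)
  refine measure_eq_zero_of_div_subset μ hker hL hL.measurableSet ?_
  rintro _ ⟨x, ⟨-, hx⟩, y, ⟨-, hy⟩, rfl⟩
  have hxy : modularCharacterFun (x / y) * modularCharacterFun y = modularCharacterFun y := by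
    rw [← modularCharacterFun_map_mul, div_mul_cancel, hx.out, hy.out]
  exact MonoidHom.mem_ker.mpr ((mul_eq_right₀ (modularCharacterFun_pos y).ne').mp hxy)

lemma measure_inter_modularCharacterFun_preimage_singleton_of_isMulRightInvariant [T2Space G]
    (ν : Measure G) [ν.IsMulRightInvariant] [IsFiniteMeasureOnCompacts ν] [ν.IsOpenPosMeasure]
    (hker : ¬IsOpen ((modularCharacter (G := G)).ker : Set G)) {K : Set G} (hK : IsCompact K)
    (c : ℝ≥0) : ν (K ∩ modularCharacterFun ⁻¹' {c}) = 0 :=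
  (measure_eq_zero_iff_of_isCompact haar ν
    (hK.inter_right (isClosed_singleton.preimage continuous_modularCharacterFun))).mpr
    (measure_inter_modularCharacterFun_preimage_singleton haar hker hK c)

lemma measure_lt_measure_of_modularCharacterFun_le_of_le [T2Space G] (μ ν : Measure G)
    [μ.IsHaarMeasure] [ν.IsMulRightInvariant] [IsFiniteMeasureOnCompacts ν] [ν.IsOpenPosMeasure]
    (hker : ¬IsOpen ((modularCharacter (G := G)).ker : Set G)) {P Q : Set G} (hP : IsCompact P)
    (hQ : IsCompact Q) (hP₀ : μ P ≠ 0) (hPQ : μ P = μ Q) {c : ℝ≥0}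
    (hPc : ∀ x ∈ P, modularCharacterFun x ≤ c) (hQc : ∀ x ∈ Q, c ≤ modularCharacterFun x) :
    ν P < ν Q := by
  obtain ⟨k, hk₀, hk⟩ := exists_measure_eq_mul_setLIntegral_modularCharacterFun μ ν
  rw [hk P hP, hk Q hQ]
  exact ENNReal.mul_lt_mul_right (by exact_mod_cast hk₀) ENNReal.coe_ne_top
    (setLIntegral_lt_setLIntegral_of_le_of_le hP.measurableSet hQ.measurableSet hPQ hP₀
      hP.measure_ne_top hPc
      (measure_inter_modularCharacterFun_preimage_singleton μ hker hP c) hQc)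

end ModularCharacter

section Connected

variable {G : Type*} [Group G] [TopologicalSpace G] [IsTopologicalGroup G] [ConnectedSpace G]

lemma coe_eq_univ_of_isOpen {H : Subgroup G} (hH : IsOpen (H : Set G)) : (H : Set G) = univ :=
  IsClopen.eq_univ ⟨H.isClosed_of_isOpen hH, hH⟩ ⟨1, H.one_mem⟩

variable [LocallyCompactSpace G]

lemma sigmaCompactSpace_of_connectedSpace : SigmaCompactSpace G := by
  obtain ⟨V, hV, hV₁⟩ := exists_compact_mem_nhds (1 : G)
  set W := V ∪ V⁻¹ with hW
  have hW_inv : W⁻¹ = W := by rw [hW, union_inv, inv_inv, union_comm]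
  have hpow (n : ℕ) : IsCompact (W ^ n) := by
    induction n with
    | zero => simp
    | succ n ih => rw [pow_succ]; exact ih.mul (hV.union hV.inv)
  let H : Subgroup G :=
    { carrier := ⋃ n : ℕ, W ^ n
      one_mem' := mem_iUnion.mpr ⟨0, by simp⟩
      mul_mem' := by
        simp only [mem_iUnion]
        rintro x y ⟨m, hx⟩ ⟨n, hy⟩
        exact ⟨m + n, pow_add W m n ▸ mul_mem_mul hx hy⟩
      inv_mem' := by
        simp only [mem_iUnion]
        rintro x ⟨n, hx⟩
        exact ⟨n, by rwa [← hW_inv, inv_pow, Set.mem_inv, inv_inv]⟩ }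
  have hWH : W ⊆ H := fun x hx ↦ mem_iUnion.mpr ⟨1, by rwa [pow_one]⟩
  have hH : IsOpen (H : Set G) :=
    H.isOpen_of_mem_nhds (g := 1) (mem_of_superset hV₁ (subset_union_left.trans hWH))
  exact isSigmaCompact_univ_iff.mp ⟨fun n ↦ W ^ n, hpow, coe_eq_univ_of_isOpen hH⟩

lemma not_isOpen_ker_modularCharacter [MeasurableSpace G] [BorelSpace G]
    {μ : Measure G} [μ.IsHaarMeasure] (hμ : ¬μ.IsMulRightInvariant) :
    ¬IsOpen ((modularCharacter (G := G)).ker : Set G) := by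
  intro hopen
  have := sigmaCompactSpace_of_connectedSpace (G := G)
  refine hμ ⟨fun g ↦ ?_⟩
  have hg : modularCharacterFun g = 1 :=
    MonoidHom.mem_ker.mp (coe_eq_univ_of_isOpen hopen ▸ mem_univ g)
  refine ext_of_iUnion_eq_univ (s := compactCovering G) (iUnion_compactCovering G) fun n ↦ ?_
  rw [measure_restrict_eq_haarScalarFactor_smul _ μ (isCompact_compactCovering G n).closure,
    ← modularCharacterFun_eq_haarScalarFactor, hg, one_smul]

end Connected

section BrunnMinkowski

variable {G : Type*} [Group G] [MeasurableSpace G] {μ ν : Measure G} {A B : Set G}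

/-- The Brunn–Minkowski inequality with exponent `1 / r` for compact sets of positive measure,
where `μ` is a left and `ν` a right Haar measure: for `r > 0` this says that `BM(G) ≥ r`. -/
def SatisfiesBrunnMinkowski [TopologicalSpace G] (μ ν : Measure G) (r : ℝ) : Prop :=
  ∀ ⦃A B : Set G⦄, IsCompact A → IsCompact B → 0 < ν A → 0 < μ B →
    (ν.real A / ν.real (A * B)) ^ (1 / r) + (μ.real B / μ.real (A * B)) ^ (1 / r) ≤ 1

variable [TopologicalSpace G] [IsTopologicalGroup G] [μ.IsMulLeftInvariant]
  [IsFiniteMeasureOnCompacts μ] [ν.IsMulRightInvariant] [IsFiniteMeasureOnCompacts ν]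

lemma measureReal_left_le_measureReal_mul (hA : IsCompact A) (hB : IsCompact B)
    (hB₀ : B.Nonempty) : ν.real A ≤ ν.real (A * B) := by
  obtain ⟨b, hb⟩ := hB₀
  calc ν.real A
    _ = ν.real (MulOpposite.op b • A) := by simp only [measureReal_def, measure_smul]
    _ ≤ ν.real (A * B) := measureReal_mono (op_smul_set_subset_mul hb) (hA.mul hB).measure_ne_top

lemma measureReal_right_le_measureReal_mul (hA : IsCompact A) (hB : IsCompact B)
    (hA₀ : A.Nonempty) : μ.real B ≤ μ.real (A * B) := by
  obtain ⟨a, ha⟩ := hA₀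
  calc μ.real B
    _ = μ.real (a • B) := by simp only [measureReal_def, measure_smul]
    _ ≤ μ.real (A * B) := measureReal_mono (smul_set_subset_mul ha) (hA.mul hB).measure_ne_top

lemma IsPairBMCoeff.rpow_add_rpow_le_one {r t : ℝ} (ht : IsPairBMCoeff μ ν A B t)
    (hA : IsCompact A) (hB : IsCompact B) (hA₀ : A.Nonempty) (hB₀ : B.Nonempty) (hr : 0 < r)
    (hrt : r ≤ t) :
    (ν.real A / ν.real (A * B)) ^ (1 / r) + (μ.real B / μ.real (A * B)) ^ (1 / r) ≤ 1 := by
  have hν : ν.real A / ν.real (A * B) ≤ 1 := div_le_one_of_le₀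
    (measureReal_left_le_measureReal_mul hA hB hB₀) measureReal_nonneg
  have hμ : μ.real B / μ.real (A * B) ≤ 1 := div_le_one_of_le₀
    (measureReal_right_le_measureReal_mul hA hB hA₀) measureReal_nonneg
  have hexp : 1 / t ≤ 1 / r := one_div_le_one_div_of_le hr hrt
  have ht₀ : 0 ≤ 1 / t := (one_div_pos.mpr ht.1).le
  calc (ν.real A / ν.real (A * B)) ^ (1 / r) + (μ.real B / μ.real (A * B)) ^ (1 / r)
    _ ≤ (ν.real A / ν.real (A * B)) ^ (1 / t) + (μ.real B / μ.real (A * B)) ^ (1 / t) :=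
      add_le_add (Real.rpow_le_rpow_of_exponent_ge' (by positivity) hν ht₀ hexp)
        (Real.rpow_le_rpow_of_exponent_ge' (by positivity) hμ ht₀ hexp)
    _ = 1 := ht.2

lemma IsGroupBMCoeff.satisfiesBrunnMinkowski {r : ℝ} (hBM : IsGroupBMCoeff μ ν r) (hr : 0 < r) :
    SatisfiesBrunnMinkowski μ ν r := by
  intro A B hA hB hνA hμB
  obtain ⟨t, ht, hrt⟩ := hBM.1.2 A B hA hB hνA hμB
  exact ht.rpow_add_rpow_le_one hA hB (nonempty_of_measure_ne_zero hνA.ne')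
    (nonempty_of_measure_ne_zero hμB.ne') hr hrt

lemma SatisfiesBrunnMinkowski.rpow_add_rpow_lt_one_of_halves {r : ℝ}
    (hBM : SatisfiesBrunnMinkowski μ ν r) (hr : 0 < r) {A₁ A₂ B₁ B₂ : Set G}
    (hA₁ : IsCompact A₁) (hA₂ : IsCompact A₂) (hB₁ : IsCompact B₁) (hB₂ : IsCompact B₂)
    (hνA : 0 < ν.real A) (hμB : 0 < μ.real B)
    (hνA₁ : ν.real A₁ = ν.real A / 2) (hνA₂ : ν.real A₂ = ν.real A / 2)
    (hμB₁ : μ.real B₁ = μ.real B / 2) (hμB₂ : μ.real B₂ = μ.real B / 2)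
    (hν : ν.real (A₁ * B₁) + ν.real (A₂ * B₂) ≤ ν.real (A * B))
    (hμ : μ.real (A₁ * B₁) + μ.real (A₂ * B₂) ≤ μ.real (A * B))
    (hne : ¬(ν.real (A₁ * B₁) = ν.real (A₂ * B₂) ∧ μ.real (A₁ * B₁) = μ.real (A₂ * B₂))) :
    (ν.real A / ν.real (A * B)) ^ (1 / r) + (μ.real B / μ.real (A * B)) ^ (1 / r) < 1 := by
  have hhalf {A' B' : Set G} (hA' : IsCompact A') (hB' : IsCompact B')
      (hνA' : ν.real A' = ν.real A / 2) (hμB' : μ.real B' = μ.real B / 2) :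
      0 < ν.real (A' * B') ∧ 0 < μ.real (A' * B') ∧
        (ν.real A / 2 / ν.real (A' * B')) ^ (1 / r) +
          (μ.real B / 2 / μ.real (A' * B')) ^ (1 / r) ≤ 1 := by
    have hνA'_pos : 0 < ν.real A' := hνA' ▸ half_pos hνA
    have hμB'_pos : 0 < μ.real B' := hμB' ▸ half_pos hμB
    have hA'₀ : A'.Nonempty := nonempty_of_measureReal_ne_zero hνA'_pos.ne'
    have hB'₀ : B'.Nonempty := nonempty_of_measureReal_ne_zero hμB'_pos.ne'
    refine ⟨hνA'_pos.trans_le (measureReal_left_le_measureReal_mul hA' hB' hB'₀),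
      hμB'_pos.trans_le (measureReal_right_le_measureReal_mul hA' hB' hA'₀), ?_⟩
    rw [← hνA', ← hμB']
    exact hBM hA' hB' (ENNReal.toReal_pos_iff.mp hνA'_pos).1
      (ENNReal.toReal_pos_iff.mp hμB'_pos).1
  obtain ⟨hN₁, hM₁, hBM₁⟩ := hhalf hA₁ hB₁ hνA₁ hμB₁
  obtain ⟨hN₂, hM₂, hBM₂⟩ := hhalf hA₂ hB₂ hνA₂ hμB₂
  exact div_rpow_add_div_rpow_lt_one hνA hμB (one_div_pos.mpr hr) hN₁ hN₂ hM₁ hM₂ hν hμ hBM₁ hBM₂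
    hne

end BrunnMinkowski

section Strictness

variable {G : Type*} [Group G] [TopologicalSpace G] [IsTopologicalGroup G] [T2Space G]
  [LocallyCompactSpace G] [MeasurableSpace G] [BorelSpace G] (μ ν : Measure G) [μ.IsHaarMeasure]
  [ν.IsMulRightInvariant] [IsFiniteMeasureOnCompacts ν] [ν.IsOpenPosMeasure] {A B : Set G}

lemma exists_isCompact_halves_mul (hker : ¬IsOpen ((modularCharacter (G := G)).ker : Set G))
    (hA : IsCompact A) (hB : IsCompact B) (hνA : ν A ≠ 0) (hμB : μ B ≠ 0) :
    ∃ c, ∃ A₁ ⊆ A, ∃ A₂ ⊆ A, ∃ B₁ ⊆ B, ∃ B₂ ⊆ B,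
      (IsCompact A₁ ∧ IsCompact A₂ ∧ IsCompact B₁ ∧ IsCompact B₂) ∧
      (ν.real A₁ = ν.real A / 2 ∧ ν.real A₂ = ν.real A / 2) ∧
      (μ.real B₁ = μ.real B / 2 ∧ μ.real B₂ = μ.real B / 2) ∧
      (∀ z ∈ A₁ * B₁, modularCharacterFun z ≤ c) ∧ ∀ z ∈ A₂ * B₂, c ≤ modularCharacterFun z := by
  obtain ⟨a, A₁, hA₁A, A₂, hA₂A, hA₁, hA₂, hΔA₁, hΔA₂, hνA₁, hνA₂⟩ :=
    exists_isCompact_halves ν continuous_modularCharacterFun hA hνA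
      (measure_inter_modularCharacterFun_preimage_singleton_of_isMulRightInvariant ν hker hA)
  obtain ⟨b, B₁, hB₁B, B₂, hB₂B, hB₁, hB₂, hΔB₁, hΔB₂, hμB₁, hμB₂⟩ :=
    exists_isCompact_halves μ continuous_modularCharacterFun hB hμB
      (measure_inter_modularCharacterFun_preimage_singleton μ hker hB)
  refine ⟨a * b, A₁, hA₁A, A₂, hA₂A, B₁, hB₁B, B₂, hB₂B, ⟨hA₁, hA₂, hB₁, hB₂⟩, ⟨hνA₁, hνA₂⟩,
    ⟨hμB₁, hμB₂⟩, ?_, ?_⟩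
  · rintro _ ⟨x, hx, y, hy, rfl⟩
    simpa only [modularCharacterFun_map_mul] using mul_le_mul' (hΔA₁ x hx) (hΔB₁ y hy)
  · rintro _ ⟨x, hx, y, hy, rfl⟩
    simpa only [modularCharacterFun_map_mul] using mul_le_mul' (hΔA₂ x hx) (hΔB₂ y hy)

theorem proposition6p1_general (hker : ¬IsOpen ((modularCharacter (G := G)).ker : Set G)) {r : ℝ}
    (hr : 0 < r) (hBM : SatisfiesBrunnMinkowski μ ν r) (hA : IsCompact A) (hB : IsCompact B)
    (hνA : 0 < ν A) (hμB : 0 < μ B) :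
    (ν.real A / ν.real (A * B)) ^ (1 / r) + (μ.real B / μ.real (A * B)) ^ (1 / r) < 1 := by
  obtain ⟨c, A₁, hA₁A, A₂, hA₂A, B₁, hB₁B, B₂, hB₂B, ⟨hA₁, hA₂, hB₁, hB₂⟩, ⟨hνA₁, hνA₂⟩,
    ⟨hμB₁, hμB₂⟩, hc₁, hc₂⟩ := exists_isCompact_halves_mul μ ν hker hA hB hνA.ne' hμB.ne'
  have hνA' : 0 < ν.real A := ENNReal.toReal_pos hνA.ne' hA.measure_ne_top
  have hμB' : 0 < μ.real B := ENNReal.toReal_pos hμB.ne' hB.measure_ne_top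
  have hP : IsCompact (A₁ * B₁) := hA₁.mul hB₁
  have hQ : IsCompact (A₂ * B₂) := hA₂.mul hB₂
  have hadd {m : Measure G} [IsFiniteMeasureOnCompacts m]
      (hlevel : m (A₁ * B₁ ∩ modularCharacterFun ⁻¹' {c}) = 0) :
      m.real (A₁ * B₁) + m.real (A₂ * B₂) ≤ m.real (A * B) :=
    measureReal_add_le_of_le_of_le hQ.measurableSet (mul_subset_mul hA₁A hB₁B)
      (mul_subset_mul hA₂A hB₂B) (hA.mul hB).measure_ne_top hc₁ hlevel hc₂
  refine hBM.rpow_add_rpow_lt_one_of_halves hr hA₁ hA₂ hB₁ hB₂ hνA' hμB' hνA₁ hνA₂ hμB₁ hμB₂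
    (hadd (measure_inter_modularCharacterFun_preimage_singleton_of_isMulRightInvariant ν hker hP c))
    (hadd (measure_inter_modularCharacterFun_preimage_singleton μ hker hP c)) ?_
  rintro ⟨hνPQ, hμPQ⟩
  have hA₁₀ : A₁.Nonempty := nonempty_of_measureReal_ne_zero (hνA₁.trans_ne (half_pos hνA').ne')
  have hμP : 0 < μ.real (A₁ * B₁) := (half_pos hμB').trans_le
    (hμB₁.symm.trans_le (measureReal_right_le_measureReal_mul hA₁ hB₁ hA₁₀))
  rw [measureReal_def, measureReal_def, ENNReal.toReal_eq_toReal_iff' hP.measure_ne_top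
    hQ.measure_ne_top] at hνPQ hμPQ
  exact (measure_lt_measure_of_modularCharacterFun_le_of_le μ ν hker hP hQ
    (ENNReal.toReal_pos_iff.mp hμP).1.ne' hμPQ hc₁ hc₂).ne hνPQ

end Strictness

theorem proposition6p1 {G : Type*} [Group G] [TopologicalSpace G] [IsTopologicalGroup G]
    [T2Space G] [LocallyCompactSpace G] [ConnectedSpace G] [MeasurableSpace G] [BorelSpace G]
    -- a left Haar measure
    (μ : Measure G) [μ.IsHaarMeasure]
    -- a right Haar measure
    (ν : Measure G) [ν.IsMulRightInvariant] [IsFiniteMeasureOnCompacts ν] [ν.IsOpenPosMeasure]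
    -- `G` is not unimodular
    (hG : ¬ μ.IsMulRightInvariant)
    (hBM : IsGroupBMCoeff μ ν 2)
    (A : Set G) (hA : IsCompact A) (hpos : 0 < μ A) :
    (ν.real A / ν.real (A * A)) ^ (1 / 2 : ℝ) + (μ.real A / μ.real (A * A)) ^ (1 / 2 : ℝ) < 1 := by
  have hνA : 0 < ν A :=
    pos_iff_ne_zero.mpr ((measure_eq_zero_iff_of_isCompact μ ν hA).not.mpr hpos.ne')
  exact proposition6p1_general μ ν (not_isOpen_ker_modularCharacter hG) two_pos
    (hBM.satisfiesBrunnMinkowski two_pos) hA hA hνA hpos
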